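/- A closure algebra is a Boolean algebra (possibly trivial) with a unary operation $\Diamond$ such that $\Diamond 0=0$, $\Diamond(a\vee b)=\Diamond a\vee\Diamond b$ and $a\le\Diamond a=\Diamond\Diamond a$ for all $a,b$; put $\Box a=\neg\Diamond\neg a$. A variety of closure algebras is the class of all closure algebras satisfying some set of identities. For a variety $\mathcal U$ of closure algebras let $\mathbf F$ be its free algebra over countably infinitely many generators, i.e. the algebra of terms in variables $v_0,v_1,\dots$ modulo the identities true in $\mathcal U$. A quasi-identity is a sentence $$q=(\forall\bar x)\,[s_1(\bar x)\approx t_1(\bar x)\wedge\dots\wedge s_n(\bar x)\approx t_n(\bar x)\to s(\bar x)\approx t(\bar x)],\qquad n\ge 0.$$ The variety $\mathcal U$ is structurally complete (SC) if every quasi-identity true in $\mathbf F$ is true in all algebras of $\mathcal U$; it is almost structurally complete (ASC) if this is so for every quasi-identity $q$ which is true in $\mathbf F$ and whose premises $s_1\approx t_1,\dots,s_n\approx t_n$ are simultaneously satisfied by some tuple of elements of $\mathbf F$. Let $\mathbf S_2$ be the four-element closure algebra in which $\Diamond 0=0$ and $\Diamond a=1$ for all $a\ne 0$. Proposition. Let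 $\mathcal U$ be an ASC variety of closure algebras. Then the following conditions are equivalent: 1. $\mathcal U$ is SC; 2. $\mathcal U$ satisfies the McKinsey identity $(\forall x)\;\Box\Diamond x\Rightarrow\Diamond\Box x\approx 1$; 3. $\mathbf S_2\notin\mathcal U$. -/

import Mathlib

universe u

/-- A closure algebra: a Boolean algebra (possibly with one element) with an operation `dia` (`◇`)
such that `◇0 = 0`, `◇(a ∨ b) = ◇a ∨ ◇b` and `a ≤ ◇a = ◇◇a`. -/
class ClosureAlgebra (A : Type u) extends BooleanAlgebra A where
  dia : A → A
  dia_bot : dia ⊥ = ⊥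
  dia_sup : ∀ a b : A, dia (a ⊔ b) = dia a ⊔ dia b
  le_dia : ∀ a : A, a ≤ dia a
  dia_dia : ∀ a : A, dia (dia a) = dia a

namespace ClosureAlgebra

/-- The operation `□a = ¬◇¬a`. -/
def box {A : Type u} [ClosureAlgebra A] (a : A) : A := (dia aᶜ)ᶜ

end ClosureAlgebra

/-- Closure algebras as single objects, so that one can speak of classes of them. -/
structure ClosureAlg where
  carrier : Type u
  inst : ClosureAlgebra carrier

namespace ClosureAlg

instance : CoeSort ClosureAlg.{u} (Type u) := ⟨carrier⟩

instance (A : ClosureAlg.{u}) : ClosureAlgebra A := A.inst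

/-- The four-element simple closure algebra `S₂`: the algebra of all subsets of a two-element set,
with `◇∅ = ∅` and `◇s` the whole set for every nonempty `s`. -/
def S₂ : ClosureAlg.{u} where
  carrier := Set (ULift.{u} Bool)
  inst :=
    { (inferInstance : BooleanAlgebra (Set (ULift.{u} Bool))) with
      dia := fun s => {_x | s.Nonempty}
      dia_bot := by
        ext x
        simp
      dia_sup := by
        intro s t
        ext x
        exact Set.union_nonempty
      le_dia := fun _ x hx => ⟨x, hx⟩
      dia_dia := by
        intro s
        ext x
        exact ⟨fun ⟨_, h⟩ => h, fun h => ⟨x, h⟩⟩ }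

end ClosureAlg

/-- Terms in the language of closure algebras over the variables `v₀, v₁, v₂, …`. -/
inductive CTerm : Type
  | var : ℕ → CTerm
  | bot : CTerm
  | top : CTerm
  | sup : CTerm → CTerm → CTerm
  | inf : CTerm → CTerm → CTerm
  | compl : CTerm → CTerm
  | dia : CTerm → CTerm

/-- The value of a term in a closure algebra under an assignment of the variables. -/
def CTerm.eval {A : Type u} [ClosureAlgebra A] (v : ℕ → A) : CTerm → A
  | .var n => v n
  | .bot => ⊥
  | .top => ⊤
  | .sup s t => s.eval v ⊔ t.eval v
  | .inf s t => s.eval v ⊓ t.eval v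
  | .compl s => (s.eval v)ᶜ
  | .dia s => ClosureAlgebra.dia (s.eval v)

/-- An equation `s ≈ t` between two terms. -/
structure CEquation where
  lhs : CTerm
  rhs : CTerm

/-- The equation is true in `A` under the assignment `v`. -/
def CEquation.TrueAt {A : Type u} [ClosureAlgebra A] (e : CEquation) (v : ℕ → A) : Prop :=
  e.lhs.eval v = e.rhs.eval v

/-- The identity `(∀ x̄) s ≈ t` holds in `A`. -/
def CEquation.HoldsIn (e : CEquation) (A : Type u) [ClosureAlgebra A] : Prop :=
  ∀ v : ℕ → A, e.TrueAt v

/-- A quasi-identity `(∀ x̄) [s₁ ≈ t₁ ∧ ⋯ ∧ sₙ ≈ tₙ → s ≈ t]`, where `n = 0` is allowed. -/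
structure QuasiIdentity where
  premises : List CEquation
  conclusion : CEquation

namespace QuasiIdentity

/-- All premises of `q` are true in `A` under the assignment `v`. -/
def PremisesTrueAt {A : Type u} [ClosureAlgebra A] (q : QuasiIdentity) (v : ℕ → A) : Prop :=
  ∀ e ∈ q.premises, e.TrueAt v

/-- The quasi-identity `q` holds in `A`. -/
def HoldsIn (q : QuasiIdentity) (A : Type u) [ClosureAlgebra A] : Prop :=
  ∀ v : ℕ → A, q.PremisesTrueAt v → q.conclusion.TrueAt v

/-- The sentence `q* = (∀ x̄) ¬ (s₁ ≈ t₁ ∧ ⋯ ∧ sₙ ≈ tₙ)` holds in `A`. -/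
def StarHoldsIn (q : QuasiIdentity) (A : Type u) [ClosureAlgebra A] : Prop :=
  ∀ v : ℕ → A, ¬ q.PremisesTrueAt v

end QuasiIdentity

/-- A class of closure algebras is a variety if it is the class of all closure algebras
satisfying some set of identities. -/
def IsVariety (U : Set ClosureAlg.{u}) : Prop :=
  ∃ E : Set CEquation, U = {A : ClosureAlg.{u} | ∀ e ∈ E, e.HoldsIn A}

/-- Two terms are identified if they determine the same term operation on every algebra in `U`. -/
def termSetoid (U : Set ClosureAlg.{u}) : Setoid CTerm where
  r s t := ∀ A ∈ U, ∀ v : ℕ → A, s.eval v = t.eval v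
  iseqv :=
    { refl := fun _ _ _ _ => rfl
      symm := fun h A hA v => (h A hA v).symm
      trans := fun h h' A hA v => (h A hA v).trans (h' A hA v) }

/-- The carrier of the free algebra `F` for `U` over `v₀, v₁, v₂, …`: terms modulo the identities
true in `U`. -/
def FreeCA (U : Set ClosureAlg.{u}) : Type := Quotient (termSetoid U)

namespace FreeCA

variable (U : Set ClosureAlg.{u})

/-- The class of a term in the free algebra. -/
def mk (t : CTerm) : FreeCA U := Quotient.mk (termSetoid U) t

instance : Max (FreeCA U) :=
  ⟨Quotient.map₂ CTerm.sup fun _ _ h _ _ h' A hA v => by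
    simp only [CTerm.eval, h A hA v, h' A hA v]⟩

instance : Min (FreeCA U) :=
  ⟨Quotient.map₂ CTerm.inf fun _ _ h _ _ h' A hA v => by
    simp only [CTerm.eval, h A hA v, h' A hA v]⟩

instance : Top (FreeCA U) := ⟨mk U .top⟩

instance : Bot (FreeCA U) := ⟨mk U .bot⟩

instance : Compl (FreeCA U) :=
  ⟨Quotient.map CTerm.compl fun _ _ h A hA v => by simp only [CTerm.eval, h A hA v]⟩

instance : SDiff (FreeCA U) := ⟨fun a b => a ⊓ bᶜ⟩

instance : HImp (FreeCA U) := ⟨fun a b => b ⊔ aᶜ⟩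

instance : LE (FreeCA U) := ⟨fun a b => a ⊔ b = b⟩

instance : LT (FreeCA U) := ⟨fun a b => a ≤ b ∧ ¬ b ≤ a⟩

/-- The operation `◇` on the free algebra. -/
def dia : FreeCA U → FreeCA U :=
  Quotient.map CTerm.dia fun _ _ h A hA v => by simp only [CTerm.eval, h A hA v]

/-- The term operations that an element of the free algebra determines on the members of `U`. -/
def toFun (a : FreeCA U) (p : Σ A : {A : ClosureAlg.{u} // A ∈ U}, ℕ → A.1) : p.1.1 :=
  Quotient.lift (fun t : CTerm => t.eval p.2) (fun _ _ (h : (termSetoid U).r _ _) => h p.1.1 p.1.2 p.2) a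

theorem toFun_injective : Function.Injective (toFun U) := by
  intro a b
  induction a using Quotient.inductionOn with | _ s =>
  induction b using Quotient.inductionOn with | _ t =>
  intro h
  exact Quotient.sound fun A hA v => congrFun h ⟨⟨A, hA⟩, v⟩

theorem toFun_sup (a b : FreeCA U) : toFun U (a ⊔ b) = toFun U a ⊔ toFun U b := by
  induction a using Quotient.inductionOn with | _ s =>
  induction b using Quotient.inductionOn with | _ t => rfl

theorem toFun_inf (a b : FreeCA U) : toFun U (a ⊓ b) = toFun U a ⊓ toFun U b := by
  induction a using Quotient.inductionOn with | _ s =>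
  induction b using Quotient.inductionOn with | _ t => rfl

theorem toFun_compl (a : FreeCA U) : toFun U aᶜ = (toFun U a)ᶜ := by
  induction a using Quotient.inductionOn with | _ s => rfl

theorem toFun_dia (a : FreeCA U) (p) : toFun U (dia U a) p = ClosureAlgebra.dia (toFun U a p) := by
  induction a using Quotient.inductionOn with | _ s => rfl

theorem toFun_le (a b : FreeCA U) : toFun U a ≤ toFun U b ↔ a ≤ b := by
  rw [← sup_eq_right, ← toFun_sup]
  exact (toFun_injective U).eq_iff

instance : BooleanAlgebra (FreeCA U) :=
  Function.Injective.booleanAlgebra (toFun U) (toFun_injective U)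
    (fun {a b} => toFun_le U a b)
    (fun {a b} => by
      rw [lt_iff_le_not_ge, toFun_le, toFun_le]
      exact Iff.rfl)
    (toFun_sup U) (toFun_inf U) rfl rfl (toFun_compl U)
    (fun a b => by
      rw [sdiff_eq, ← toFun_compl, ← toFun_inf]
      rfl)
    (fun a b => by
      rw [himp_eq, ← toFun_compl, ← toFun_sup]
      rfl)

/-- The free algebra `F` for `U` over countably many generators, as a closure algebra. -/
instance : ClosureAlgebra (FreeCA U) where
  dia := dia U
  dia_bot := by
    apply toFun_injective U
    funext p
    exact (toFun_dia U ⊥ p).trans ClosureAlgebra.dia_bot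
  dia_sup := by
    intro a b
    apply toFun_injective U
    funext p
    have h₁ : toFun U (dia U (a ⊔ b)) p = ClosureAlgebra.dia (toFun U a p ⊔ toFun U b p) :=
      (toFun_dia U _ p).trans (congrArg _ (congrFun (toFun_sup U a b) p))
    have h₂ : toFun U (dia U a ⊔ dia U b) p = toFun U (dia U a) p ⊔ toFun U (dia U b) p :=
      congrFun (toFun_sup U _ _) p
    refine h₁.trans (Eq.trans ?_ h₂.symm)
    rw [toFun_dia, toFun_dia, ClosureAlgebra.dia_sup]
  le_dia := by
    intro a
    rw [← toFun_le]
    intro p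
    rw [toFun_dia]
    exact ClosureAlgebra.le_dia _
  dia_dia := by
    intro a
    apply toFun_injective U
    funext p
    rw [toFun_dia, toFun_dia, ClosureAlgebra.dia_dia]

end FreeCA

/-- `U` is structurally complete: every quasi-identity true in `F` is true in `U`. -/
def IsSC (U : Set ClosureAlg.{u}) : Prop :=
  ∀ q : QuasiIdentity, q.HoldsIn (FreeCA U) → ∀ A ∈ U, q.HoldsIn A

/-- A quasi-identity is `U`-active if it is true in `F` while `q*` is not. -/
def QuasiIdentity.IsActive (q : QuasiIdentity) (U : Set ClosureAlg.{u}) : Prop :=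
  q.HoldsIn (FreeCA U) ∧ ¬ q.StarHoldsIn (FreeCA U)

/-- `U` is almost structurally complete: every `U`-active quasi-identity holds in `U`. -/
def IsASC (U : Set ClosureAlg.{u}) : Prop :=
  ∀ q : QuasiIdentity, q.IsActive U → ∀ A ∈ U, q.HoldsIn A

/-- `U` satisfies the McKinsey identity `□◇x ⇒ ◇□x ≈ 1`. -/
def SatisfiesMcKinsey (U : Set ClosureAlg.{u}) : Prop :=
  ∀ A ∈ U, ∀ x : A, (ClosureAlgebra.box (ClosureAlgebra.dia x) ⇨
    ClosureAlgebra.dia (ClosureAlgebra.box x)) = ⊤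

/-! For open `y`, the map `a ↦ a ⊓ y` is a quotient onto the algebra below `y`. No quotient is
built: terms are compared modulo `y` (`IsHomModulo.eval`). McKinsey gives SC: in a nontrivial
McKinsey algebra some nonzero open `y` makes any finitely many elements 0 or 1 modulo `y`. Premises
satisfiable there are therefore satisfied by constants 0 and 1, hence also in `F`; so every
quasi-identity true in `F` holds in that algebra, by ASC. Without `S₂`, McKinsey holds: if it fails
at `x`, then `y = □◇x ∧ □◇¬x` is nonzero and open, and modulo `y` the element `x` generates a copy
of `S₂`, which then inherits all identities. SC excludes `S₂`: if `S₂ ∈ U`, then `◇x ∧ ◇¬x ≈ 1` has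
no solution in `F` but has one in `S₂`. -/

namespace ClosureAlgebra

/-! ### Open elements and relativization. -/

variable {A : Type*} [ClosureAlgebra A]

theorem dia_mono {a b : A} (h : a ≤ b) : dia a ≤ dia b := by
  rw [← sup_eq_right] at h ⊢
  rw [← dia_sup, h]

theorem dia_top : dia (⊤ : A) = ⊤ := top_le_iff.mp (le_dia ⊤)

theorem box_le (a : A) : box a ≤ a := compl_le_of_compl_le (le_dia aᶜ)

/-- An element is open if it is a fixed point of `□`. -/
def IsOpenElement (y : A) : Prop := box y = y

theorem IsOpenElement.dia_compl {y : A} (hy : IsOpenElement y) : dia yᶜ = yᶜ := by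
  have h : (dia yᶜ)ᶜ = y := hy
  rw [← h, compl_compl, dia_dia]

theorem isOpenElement_of_dia_compl {y : A} (h : dia yᶜ = yᶜ) : IsOpenElement y := by
  rw [IsOpenElement, box, h, compl_compl]

theorem isOpenElement_box (a : A) : IsOpenElement (box a) :=
  isOpenElement_of_dia_compl (by rw [box, compl_compl, dia_dia])

theorem isOpenElement_top : IsOpenElement (⊤ : A) :=
  isOpenElement_of_dia_compl (by rw [compl_top, dia_bot])

theorem IsOpenElement.inf {y z : A} (hy : IsOpenElement y) (hz : IsOpenElement z) :
    IsOpenElement (y ⊓ z) :=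
  isOpenElement_of_dia_compl (by rw [compl_inf, dia_sup, hy.dia_compl, hz.dia_compl])

/-- Modulo an open element `y`, the value of `◇a` depends only on `a` modulo `y`. -/
theorem IsOpenElement.dia_inf {y : A} (hy : IsOpenElement y) (a : A) :
    dia (a ⊓ y) ⊓ y = dia a ⊓ y := by
  apply le_antisymm (inf_le_inf_right y (dia_mono inf_le_left))
  refine le_inf ?_ inf_le_right
  have h : dia a ≤ dia (a ⊓ y) ⊔ yᶜ := by
    rw [← hy.dia_compl, ← dia_sup]
    apply dia_mono
    rw [sup_inf_right, sup_compl_eq_top, inf_top_eq]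
    exact le_sup_left
  calc dia a ⊓ y ≤ (dia (a ⊓ y) ⊔ yᶜ) ⊓ y := inf_le_inf_right y h
    _ ≤ dia (a ⊓ y) := by
      rw [inf_sup_right, inf_comm yᶜ, inf_compl_eq_bot, sup_bot_eq]
      exact inf_le_left

theorem IsOpenElement.dia_congr {y a b : A} (hy : IsOpenElement y) (h : a ⊓ y = b ⊓ y) :
    dia a ⊓ y = dia b ⊓ y := by
  rw [← hy.dia_inf a, ← hy.dia_inf b, h]

theorem compl_inf_congr {y a b : A} (h : a ⊓ y = b ⊓ y) : aᶜ ⊓ y = bᶜ ⊓ y := by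
  have key : ∀ c : A, cᶜ ⊓ y = (c ⊓ y)ᶜ ⊓ y := fun c => by
    rw [compl_inf, inf_sup_right, inf_comm yᶜ, inf_compl_eq_bot, sup_bot_eq]
  rw [key a, key b, h]

/-- A map that becomes a homomorphism of closure algebras after relativization to `y`. -/
structure IsHomModulo {B : Type*} [ClosureAlgebra B] (f : B → A) (y : A) : Prop where
  bot : f ⊥ ⊓ y = ⊥
  sup : ∀ a b, f (a ⊔ b) ⊓ y = (f a ⊔ f b) ⊓ y
  compl : ∀ a, f aᶜ ⊓ y = (f a)ᶜ ⊓ y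
  dia : ∀ a, f (dia a) ⊓ y = ClosureAlgebra.dia (f a) ⊓ y

/-- The two-element closure algebra. -/
instance : ClosureAlgebra Bool where
  dia := id
  dia_bot := rfl
  dia_sup _ _ := rfl
  le_dia _ := le_rfl
  dia_dia _ := rfl

/-- The canonical map from the two-element closure algebra. -/
def ofBool (b : Bool) : A := if b then ⊤ else ⊥

theorem isHomModulo_ofBool (y : A) : IsHomModulo (ofBool : Bool → A) y where
  bot := bot_inf_eq y
  sup a b := by cases a <;> cases b <;> simp [ofBool]
  compl a := by cases a <;> simp [ofBool]
  dia a := by cases a <;> simp [ofBool, dia_bot, dia_top, ClosureAlgebra.dia]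

theorem ofBool_inf_injective {y : A} (hy : y ≠ ⊥) :
    Function.Injective fun b => (ofBool b : A) ⊓ y := by
  intro a b h
  cases a <;> cases b <;> simp_all [ofBool, eq_comm]

/-- In a McKinsey algebra, a nonzero open element can be shrunk so as to decide finitely many
given elements. -/
theorem exists_isOpenElement_decides (hA : ∀ x : A, box (dia x) ⇨ dia (box x) = ⊤) [Nontrivial A]
    (v : ℕ → A) (S : Finset ℕ) :
    ∃ y : A, IsOpenElement y ∧ y ≠ ⊥ ∧ ∃ b : ℕ → Bool, ∀ n ∈ S, v n ⊓ y = ofBool (b n) ⊓ y := by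
  classical
  induction S using Finset.induction_on with
  | empty => exact ⟨⊤, isOpenElement_top, top_ne_bot, fun _ => true, by simp⟩
  | insert n S hn ih =>
    obtain ⟨y, hy, hy0, b, hb⟩ := ih
    have key : ∀ (z : A) (c : Bool), IsOpenElement z → z ⊓ y ≠ ⊥ → v n ⊓ z = ofBool c ⊓ z →
        ∃ y : A, IsOpenElement y ∧ y ≠ ⊥ ∧
          ∃ b : ℕ → Bool, ∀ m ∈ insert n S, v m ⊓ y = ofBool (b m) ⊓ y := by
      intro z c hz hzy hc
      refine ⟨z ⊓ y, hz.inf hy, hzy, Function.update b n c, fun m hm => ?_⟩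
      by_cases hmn : m = n
      · subst hmn
        rw [Function.update_self, ← inf_assoc, hc, inf_assoc]
      · rw [Function.update_of_ne hmn, inf_left_comm,
          hb m (Finset.mem_of_mem_insert_of_ne hm hmn), inf_left_comm]
    by_cases h₁ : box (v n) ⊓ y = ⊥
    · by_cases h₂ : box (v n)ᶜ ⊓ y = ⊥
      -- Otherwise `y` is disjoint from both `◇□v` and `◇□¬v`, so `y ≤ ¬◇□¬v = □◇v ≤ ◇□v` by
      -- McKinsey, which forces `y = ⊥`.
      · exfalso
        apply hy0
        have e₁ : dia (box (v n)) ⊓ y = ⊥ := by rw [← hy.dia_inf, h₁, dia_bot, bot_inf_eq]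
        have e₂ : dia (box (v n)ᶜ) ⊓ y = ⊥ := by rw [← hy.dia_inf, h₂, dia_bot, bot_inf_eq]
        have h := himp_eq_top_iff.mp (hA (v n))
        have e₃ : box (dia (v n)) = (dia (box (v n)ᶜ))ᶜ := by simp only [box, compl_compl]
        rw [e₃] at h
        rw [← disjoint_iff] at e₁ e₂
        exact le_bot_iff.mp ((le_inf (e₂.symm.le_compl_right.trans h) le_rfl).trans e₁.le_bot)
      · refine key _ false (isOpenElement_box _) h₂ ?_
        have h : box (v n)ᶜ ≤ (v n)ᶜ := box_le _
        rw [ofBool, if_neg (by simp), bot_inf_eq]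
        exact (disjoint_compl_right.mono_right h).eq_bot
    · refine key _ true (isOpenElement_box _) h₁ ?_
      rw [ofBool, if_pos rfl, top_inf_eq]
      exact inf_eq_right.mpr (box_le _)

end ClosureAlgebra

/-! ### Terms modulo an open element, and McKinsey implies SC. -/

open ClosureAlgebra

/-- The variables that occur in a term. -/
def CTerm.vars : CTerm → Finset ℕ
  | .var n => {n}
  | .bot => ∅
  | .top => ∅
  | .sup s t => s.vars ∪ t.vars
  | .inf s t => s.vars ∪ t.vars
  | .compl s => s.vars
  | .dia s => s.vars

/-- Each operation respects equality modulo `y`; openness of `y` is needed only for `◇`. Agreement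
modulo `y` on the occurring variables is all that the finite decision lemma can supply. -/
theorem ClosureAlgebra.IsHomModulo.eval {A B : Type*} [ClosureAlgebra A] [ClosureAlgebra B]
    {f : B → A} {y : A} (hf : IsHomModulo f y) (hy : IsOpenElement y) {v : ℕ → B} {w : ℕ → A}
    (t : CTerm) (h : ∀ n ∈ t.vars, w n ⊓ y = f (v n) ⊓ y) :
    t.eval w ⊓ y = f (t.eval v) ⊓ y := by
  induction t with
  | var n => exact h n (Finset.mem_singleton_self n)
  | bot => exact (bot_inf_eq y).trans hf.bot.symm
  | top =>
    have h := (hf.compl ⊥).trans (compl_inf_congr (hf.bot.trans (bot_inf_eq y).symm))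
    rw [compl_bot, compl_bot] at h
    exact h.symm
  | sup s t hs ht =>
    have hs := hs fun n hn => h n (Finset.mem_union_left _ hn)
    have ht := ht fun n hn => h n (Finset.mem_union_right _ hn)
    simp only [CTerm.eval]
    rw [hf.sup, inf_sup_right, inf_sup_right, hs, ht]
  | inf s t hs ht =>
    have hs := hs fun n hn => h n (Finset.mem_union_left _ hn)
    have ht := ht fun n hn => h n (Finset.mem_union_right _ hn)
    simp only [CTerm.eval]
    -- Meets are not part of `IsHomModulo`; De Morgan recovers them.
    have e : f (s.eval v ⊓ t.eval v) ⊓ y = (f (s.eval v) ⊓ f (t.eval v)) ⊓ y := by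
      rw [← compl_compl (s.eval v ⊓ t.eval v), hf.compl, compl_inf,
        compl_inf_congr (hf.sup _ _), compl_sup, inf_inf_distrib_right,
        compl_inf_congr (hf.compl _), compl_inf_congr (hf.compl _), compl_compl, compl_compl,
        ← inf_inf_distrib_right]
    rw [e, inf_inf_distrib_right, hs, ht, ← inf_inf_distrib_right]
  | compl s hs => exact (compl_inf_congr (hs h)).trans (hf.compl _).symm
  | dia s hs => exact (hy.dia_congr (hs h)).trans (hf.dia _).symm

theorem CTerm.eval_ofBool {A : Type*} [ClosureAlgebra A] (b : ℕ → Bool) (t : CTerm) :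
    t.eval (fun n => (ofBool (b n) : A)) = ofBool (t.eval b) := by
  simpa using (isHomModulo_ofBool (⊤ : A)).eval isOpenElement_top t fun _ _ => rfl

/-- Premises satisfiable in a nontrivial McKinsey algebra are satisfiable in every closure
algebra. -/
theorem QuasiIdentity.exists_premisesTrueAt {A : Type*} [ClosureAlgebra A] [Nontrivial A]
    (hA : ∀ x : A, box (dia x) ⇨ dia (box x) = ⊤) {q : QuasiIdentity} {v : ℕ → A}
    (hv : q.PremisesTrueAt v) (C : Type*) [ClosureAlgebra C] :
    ∃ w : ℕ → C, q.PremisesTrueAt w := by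
  classical
  let S : Finset ℕ := q.premises.toFinset.biUnion fun e => e.lhs.vars ∪ e.rhs.vars
  obtain ⟨y, hy, hy0, b, hb⟩ := exists_isOpenElement_decides hA v S
  refine ⟨fun n => ofBool (b n), fun e he => ?_⟩
  have hS : e.lhs.vars ∪ e.rhs.vars ⊆ S :=
    Finset.subset_biUnion_of_mem (fun e : CEquation => e.lhs.vars ∪ e.rhs.vars)
      (List.mem_toFinset.mpr he)
  have hl := (isHomModulo_ofBool y).eval hy e.lhs
    fun n hn => hb n (hS (Finset.mem_union_left _ hn))
  have hr := (isHomModulo_ofBool y).eval hy e.rhs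
    fun n hn => hb n (hS (Finset.mem_union_right _ hn))
  have heq : e.lhs.eval v = e.rhs.eval v := hv e he
  rw [heq, hr] at hl
  rw [CEquation.TrueAt, CTerm.eval_ofBool, CTerm.eval_ofBool, ofBool_inf_injective hy0 hl]

theorem IsASC.isSC_of_satisfiesMcKinsey {U : Set ClosureAlg.{u}} (hASC : IsASC U)
    (hM : SatisfiesMcKinsey U) : IsSC U := by
  intro q hq A hA v hv
  rcases subsingleton_or_nontrivial A with _ | _
  · exact Subsingleton.elim _ _
  -- The premises hold at `v` in `A`, hence are satisfiable in `F`, so `q` is active.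
  · obtain ⟨w, hw⟩ := QuasiIdentity.exists_premisesTrueAt (hM A hA) hv (FreeCA U)
    exact hASC q ⟨hq, fun h => h w hw⟩ A hA v hv

/-! ### Copies of `S₂` where the McKinsey identity fails. -/

namespace ClosureAlg

theorem dia_S₂_of_ne_bot {s : S₂.{u}} (h : s ≠ ⊥) : dia s = ⊤ := by
  have h : Set.Nonempty (s : Set (ULift.{u} Bool)) := Set.nonempty_iff_ne_empty.mpr h
  exact Set.eq_univ_of_forall fun _ => h

/-- The atom of `S₂` given by the first point. -/
def atomS₂ : S₂.{u} := ({⟨true⟩} : Set (ULift.{u} Bool))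

theorem atomS₂_ne_bot : atomS₂.{u} ≠ ⊥ :=
  Set.singleton_ne_empty (⟨true⟩ : ULift.{u} Bool)

theorem compl_atomS₂_ne_bot : atomS₂.{u}ᶜ ≠ ⊥ := by
  intro h
  have h : ((⟨false⟩ : ULift.{u} Bool) ∈ ({⟨true⟩}ᶜ : Set (ULift.{u} Bool))) = False :=
    congrFun h _
  simp at h

theorem eq_of_S₂ (s : S₂.{u}) : s = ⊥ ∨ s = ⊤ ∨ s = atomS₂ ∨ s = atomS₂ᶜ := by
  have key : ∀ s : Set (ULift.{u} Bool),
      s = ∅ ∨ s = Set.univ ∨ s = {⟨true⟩} ∨ s = {⟨true⟩}ᶜ := by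
    intro s
    by_cases h₁ : (⟨true⟩ : ULift.{u} Bool) ∈ s <;> by_cases h₂ : (⟨false⟩ : ULift.{u} Bool) ∈ s
    · exact .inr (.inl (by ext ⟨x⟩; cases x <;> simp [h₁, h₂]))
    · exact .inr (.inr (.inl (by ext ⟨x⟩; cases x <;> simp [h₁, h₂])))
    · exact .inr (.inr (.inr (by ext ⟨x⟩; cases x <;> simp [h₁, h₂])))
    · exact .inl (by ext ⟨x⟩; cases x <;> simp [h₁, h₂])
  exact key s

open Classical in
/-- The map from `S₂` to a closure algebra that sends the two atoms to `x` and `xᶜ`. -/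
noncomputable def ofS₂ {A : Type*} [ClosureAlgebra A] (x : A) (s : S₂.{u}) : A :=
  (if atomS₂ ≤ s then x else ⊥) ⊔ (if atomS₂ᶜ ≤ s then xᶜ else ⊥)

section

variable {A : Type*} [ClosureAlgebra A] (x : A)

theorem ofS₂_bot : ofS₂ x (⊥ : S₂.{u}) = ⊥ := by
  rw [ofS₂, if_neg (mt le_bot_iff.mp atomS₂_ne_bot), if_neg (mt le_bot_iff.mp compl_atomS₂_ne_bot),
    sup_bot_eq]

theorem ofS₂_top : ofS₂ x (⊤ : S₂.{u}) = ⊤ := by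
  rw [ofS₂, if_pos le_top, if_pos le_top, sup_compl_eq_top]

theorem ofS₂_atom : ofS₂ x atomS₂.{u} = x := by
  rw [ofS₂, if_pos le_rfl, if_neg (mt compl_le_self.mp fun h =>
    compl_atomS₂_ne_bot (by rw [h, compl_top])), sup_bot_eq]

theorem ofS₂_compl_atom : ofS₂ x atomS₂.{u}ᶜ = xᶜ := by
  rw [ofS₂, if_pos le_rfl, if_neg (mt le_compl_self.mp atomS₂_ne_bot), bot_sup_eq]

/-- If `y` lies below both `◇x` and `◇¬x`, then `x` generates a copy of `S₂` modulo `y`. -/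
theorem isHomModulo_ofS₂ {x y : A} (h₁ : y ≤ dia x) (h₂ : y ≤ dia xᶜ) :
    IsHomModulo (ofS₂ x : S₂.{u} → A) y where
  bot := by rw [ofS₂_bot, bot_inf_eq]
  sup a b := by
    congr 1
    rcases eq_of_S₂ a with rfl | rfl | rfl | rfl <;>
    rcases eq_of_S₂ b with rfl | rfl | rfl | rfl <;>
    simp [ofS₂_bot, ofS₂_top, ofS₂_atom, ofS₂_compl_atom]
  compl a := by
    rcases eq_of_S₂ a with rfl | rfl | rfl | rfl <;>
    simp [ofS₂_bot, ofS₂_top, ofS₂_atom, ofS₂_compl_atom]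
  dia a := by
    rcases eq_of_S₂ a with rfl | rfl | rfl | rfl
    · rw [dia_bot, ofS₂_bot, dia_bot]
    · rw [dia_top, ofS₂_top, dia_top]
    · rw [dia_S₂_of_ne_bot atomS₂_ne_bot, ofS₂_top, ofS₂_atom, top_inf_eq, inf_eq_right.mpr h₁]
    · rw [dia_S₂_of_ne_bot compl_atomS₂_ne_bot, ofS₂_top, ofS₂_compl_atom, top_inf_eq,
        inf_eq_right.mpr h₂]

/-- The kernel is trivial: if `z ⊓ y = ⊥`, then `◇z ⊓ y = ⊥` as `y` is open, which is impossible for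
nonzero `y ≤ ◇z`. -/
theorem ofS₂_inf_injective {x y : A} (h₁ : y ≤ dia x) (h₂ : y ≤ dia xᶜ) (hy : IsOpenElement y)
    (hy0 : y ≠ ⊥) : Function.Injective fun s : S₂.{u} => ofS₂ x s ⊓ y := by
  have hx : ∀ z : A, y ≤ dia z → z ⊓ y ≠ ⊥ := fun z hz h => hy0 (by
    have h' := hy.dia_inf z
    rwa [h, dia_bot, bot_inf_eq, inf_eq_right.mpr hz, eq_comm] at h')
  have hx₁ := hx x h₁
  have hx₂ := hx xᶜ h₂
  have key : ∀ s : S₂.{u}, ofS₂ x s ⊓ y = ⊥ → s = ⊥ := by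
    intro s hs
    rcases eq_of_S₂ s with rfl | rfl | rfl | rfl
    · rfl
    · rw [ofS₂_top, top_inf_eq] at hs
      exact absurd hs hy0
    · rw [ofS₂_atom] at hs
      exact absurd hs hx₁
    · rw [ofS₂_compl_atom] at hs
      exact absurd hs hx₂
  have hf := isHomModulo_ofS₂.{u} h₁ h₂
  -- The difference `s ⊓ tᶜ`, written `(sᶜ ⊔ t)ᶜ` to use only the fields of `IsHomModulo`, lies in
  -- the kernel.
  have sdiff : ∀ s t : S₂.{u}, ofS₂ x s ⊓ y = ofS₂ x t ⊓ y → s ≤ t := by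
    intro s t h
    have h' : ofS₂ x (sᶜ ⊔ t)ᶜ ⊓ y = ⊥ := by
      have e : (ofS₂ x (sᶜ ⊔ t)) ⊓ y = ⊤ ⊓ y := by
        rw [hf.sup, inf_sup_right, hf.compl, compl_inf_congr h, ← inf_sup_right,
          sup_comm, sup_compl_eq_top]
      rw [hf.compl, compl_inf_congr e, compl_top, bot_inf_eq]
    have h'' := key _ h'
    rw [compl_sup, compl_compl] at h''
    exact disjoint_compl_right_iff.mp (disjoint_iff.mpr h'')
  exact fun s t h => le_antisymm (sdiff s t h) (sdiff t s h.symm)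

end

/-- An identity that holds in an algebra refuting the McKinsey identity holds in `S₂`. -/
theorem holdsIn_S₂ {A : Type*} [ClosureAlgebra A] {x : A}
    (hx : box (dia x) ⇨ dia (box x) ≠ ⊤) {e : CEquation} (he : e.HoldsIn A) :
    e.HoldsIn S₂.{u} := by
  intro v
  let y : A := box (dia x) ⊓ box (dia xᶜ)
  have hy : IsOpenElement y := (isOpenElement_box _).inf (isOpenElement_box _)
  have hy0 : y ≠ ⊥ := fun h => hx <| himp_eq_top_iff.mpr <| by
    have e' : box (dia xᶜ) = (dia (box x))ᶜ := by simp only [box]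
    change box (dia x) ⊓ box (dia xᶜ) = ⊥ at h
    rw [e'] at h
    exact disjoint_compl_right_iff.mp (disjoint_iff.mpr h)
  have h₁ : y ≤ dia x := inf_le_left.trans (box_le _)
  have h₂ : y ≤ dia xᶜ := inf_le_right.trans (box_le _)
  have hf := isHomModulo_ofS₂.{u} h₁ h₂
  have hl := hf.eval hy (v := v) (w := fun n => ofS₂ x (v n)) e.lhs fun _ _ => rfl
  have hr := hf.eval hy (v := v) (w := fun n => ofS₂ x (v n)) e.rhs fun _ _ => rfl
  have heq : e.lhs.eval (fun n => ofS₂ x (v n)) = e.rhs.eval (fun n => ofS₂ x (v n)) := he _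
  rw [heq, hr] at hl
  exact (ofS₂_inf_injective h₁ h₂ hy hy0 hl).symm

end ClosureAlg

open ClosureAlg

theorem IsVariety.satisfiesMcKinsey_of_S₂_notMem {U : Set ClosureAlg.{u}} (hU : IsVariety U)
    (h : S₂.{u} ∉ U) : SatisfiesMcKinsey U := by
  obtain ⟨E, rfl⟩ := hU
  intro A hA x
  by_contra hx
  exact h fun e he => holdsIn_S₂ hx (hA e he)

/-! ### A quasi-identity vacuously true in `F`. -/

/-- The quasi-identity `◇x ∧ ◇¬x ≈ 1 → 0 ≈ 1`. -/
def passiveQuasiIdentity : QuasiIdentity where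
  premises := [⟨.inf (.dia (.var 0)) (.dia (.compl (.var 0))), .top⟩]
  conclusion := ⟨.bot, .top⟩

theorem passiveQuasiIdentity_holdsIn_freeCA {U : Set ClosureAlg.{u}} (h : S₂.{u} ∈ U) :
    passiveQuasiIdentity.HoldsIn (FreeCA U) := by
  intro v hv
  exfalso
  have hv0 : dia (v 0) ⊓ dia (v 0)ᶜ = ⊤ := hv _ (List.mem_singleton_self _)
  obtain ⟨t, ht⟩ := Quotient.exists_rep (v 0)
  rw [← ht] at hv0
  -- A solution `t` in `F` would give an identity of `S₂`. With all variables set to 0, `t` takes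
  -- the value 0 or 1, so one of `◇t`, `◇¬t` is 0.
  have h' : dia (t.eval fun _ => (ofBool false : S₂.{u})) ⊓
      dia (t.eval fun _ => (ofBool false : S₂.{u}))ᶜ = ⊤ :=
    (Quotient.exact hv0 : (termSetoid U).r
      (.inf (.dia t) (.dia (.compl t))) .top) S₂ h fun _ => ofBool false
  rw [CTerm.eval_ofBool fun _ => false] at h'
  have hbot : (⊥ : S₂.{u}) = ⊤ := by
    cases hb : t.eval (fun _ => false) <;> simpa [hb, ofBool, dia_bot, dia_top] using h'
  exact atomS₂_ne_bot (le_bot_iff.mp (hbot ▸ le_top))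

theorem passiveQuasiIdentity_not_holdsIn_S₂ : ¬ passiveQuasiIdentity.HoldsIn S₂.{u} := by
  intro h
  have hbot : (⊥ : S₂.{u}) = ⊤ := h (fun _ => atomS₂) fun e he => by
    rw [List.mem_singleton.mp he]
    change dia atomS₂ ⊓ dia atomS₂ᶜ = ⊤
    rw [dia_S₂_of_ne_bot atomS₂_ne_bot, dia_S₂_of_ne_bot compl_atomS₂_ne_bot, inf_top_eq]
  exact atomS₂_ne_bot (le_bot_iff.mp (hbot ▸ le_top))

theorem proposition8p7 (U : Set ClosureAlg.{u}) (hU : IsVariety U) (hASC : IsASC U) :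
    [IsSC U, SatisfiesMcKinsey U, ClosureAlg.S₂.{u} ∉ U].TFAE := by
  tfae_have 1 → 3 := fun h hS => passiveQuasiIdentity_not_holdsIn_S₂
    (h _ (passiveQuasiIdentity_holdsIn_freeCA hS) S₂ hS)
  tfae_have 3 → 2 := hU.satisfiesMcKinsey_of_S₂_notMem
  tfae_have 2 → 1 := hASC.isSC_of_satisfiesMcKinsey
  tfae_finish
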